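/- A Motzkin permutation of length $n\ge 0$ is a permutation $\pi=\pi_1\cdots\pi_n$ of $\{1,\dots,n\}$ that avoids $132$ (there are no $a<b<c$ with $\pi_a<\pi_c<\pi_b$) and avoids $1\text{-}23$ (there are no $a<b<n$ with $\pi_a<\pi_b<\pi_{b+1}$). For $k\ge 3$, an occurrence of the generalized pattern $21\text{-}3\text{-}\cdots\text{-}k$ in $\pi$ is a sequence of positions $i_1<i_2<\cdots<i_k$ with $i_2=i_1+1$ and $\pi_{i_2}<\pi_{i_1}<\pi_{i_3}<\pi_{i_4}<\cdots<\pi_{i_k}$. Let $N_k(x;r)=\sum_{n\ge 0}c_n x^n$, where $c_n$ is the number of Motzkin permutations of length $n$ that contain $21\text{-}3\text{-}\cdots\text{-}k$ exactly $r$ times. Let $U_m$ ($m\in\mathbb Z$) be the Chebyshev polynomials of the second kind, given by $U_0(t)=1$, $U_1(t)=2t$ and $U_m(t)=2tU_{m-1}(t)-U_{m-2}(t)$ for all $m\in\mathbb Z$ (so $U_{-1}=0$), and write $U_m$ for $U_m\!\left(\frac{1-x}{2x}\right)$ below. Theorem. For every $k\ge 3$, as formal Laurent series in $x$ over $\mathbb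 Q$, $$N_k(x;0)=\frac{U_{k-3}-xU_{k-4}}{x\,(U_{k-2}-xU_{k-3})},$$ and for all $r=1,2,\dots,k-1$, $$N_k(x;r)=\frac{x^r(1+x)^r\,U_{k-2}^{\,r-1}}{(U_{k-2}-xU_{k-3})^{\,r+1}}.$$ -/

import Mathlib

/-- A (generalized) pattern with `k` letters: the word `letter 0, …, letter (k - 1)`, together with
the set of those (0-based) positions `p` for which there is no dash between the letters in
positions `p` and `p + 1`, i.e. for which these two letters have to be adjacent in an occurrence. -/
structure GenPattern (k : ℕ) where
  letter : Fin k → ℕ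
  glued : Finset ℕ

/-- The positions `i 0 < i 1 < ⋯ < i (k - 1)` of `π = π₁ ⋯ πₙ` form an occurrence of `p`: the
letters of `π` there are in the same relative order as those of `p`, and those which have to be
adjacent are. -/
def IsOccurrence {k n : ℕ} (p : GenPattern k) (π : Equiv.Perm (Fin n)) (i : Fin k → Fin n) : Prop :=
  StrictMono i ∧
    (∀ a b : Fin k, π (i a) < π (i b) ↔ p.letter a < p.letter b) ∧
    ∀ a b : Fin k, (b : ℕ) = a + 1 → (a : ℕ) ∈ p.glued → (i b : ℕ) = i a + 1

/-- The number of occurrences of the pattern `p` in `π`. -/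
noncomputable def numOccurrences {k n : ℕ} (p : GenPattern k) (π : Equiv.Perm (Fin n)) : ℕ :=
  Set.ncard {i : Fin k → Fin n | IsOccurrence p π i}

/-- `π` avoids the pattern `p`. -/
def Avoids {k n : ℕ} (p : GenPattern k) (π : Equiv.Perm (Fin n)) : Prop :=
  ∀ i : Fin k → Fin n, ¬ IsOccurrence p π i

/-- The classical pattern `132` (all dashes present). -/
def pattern132 : GenPattern 3 := ⟨![1, 3, 2], ∅⟩

/-- The generalized pattern `1-23`. -/
def pattern1d23 : GenPattern 3 := ⟨![1, 2, 3], {1}⟩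

/-- The generalized pattern `21-3-⋯-k`. -/
def pattern21d (k : ℕ) : GenPattern k :=
  ⟨fun j => if (j : ℕ) = 0 then 2 else if (j : ℕ) = 1 then 1 else j + 1, {0}⟩

/-- Motzkin permutations: those which avoid `132` and `1-23`. -/
def IsMotzkin {n : ℕ} (π : Equiv.Perm (Fin n)) : Prop :=
  Avoids pattern132 π ∧ Avoids pattern1d23 π

/-- The generating function `∑ₙ #{π ∈ 𝔐ₙ : π contains p exactly r times} xⁿ` for the number of
Motzkin permutations which contain `p` exactly `r` times. -/
noncomputable def motzkinGF {k : ℕ} (p : GenPattern k) (r : ℕ) : PowerSeries ℚ :=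
  PowerSeries.mk fun n =>
    (Set.ncard {π : Equiv.Perm (Fin n) | IsMotzkin π ∧ numOccurrences p π = r} : ℚ)

/-- The variable `x`, in the field of formal Laurent series, which contains both the formal power
series and the rational functions in `x`. -/
noncomputable def xL : LaurentSeries ℚ := ((PowerSeries.X : PowerSeries ℚ) : LaurentSeries ℚ)

/-- `U_m((1 - x) / (2x))`, where `U_m` (`m ∈ ℤ`) is the Chebyshev polynomial of the second kind. -/
noncomputable def chebU (m : ℤ) : LaurentSeries ℚ :=
  Polynomial.aeval ((1 - xL) / (2 * xL)) (Polynomial.Chebyshev.U ℚ m)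

/-! Cut a nonempty Motzkin permutation at its largest letter `M`. Avoiding 132 forces every letter
before `M` above every letter after it; avoiding 1-23 forces the letter `m` just before `M`, if
there is one, to be the smallest before `M`. So the word is `M τ` or `σ m M τ` with `σ`, `τ` again
Motzkin, which encodes these permutations by unary-binary trees.

Let `d_j` count 21-3-⋯-(j+2), with a small letter imagined at the end of the word. Blocks in
decreasing position add up, while appending `m M` to `σ` turns `d_j` into `d_j + d_(j-1)`, because
`M` extends every shorter occurrence. With binomial weights, `weight K i = ∑ choose i (K - j) * d_j`
is therefore additive along the tree, the index `i` rising by one on entering `σ`; `weight K 0` is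
`d_K` and `K = k - 2`. Marking weight by `y`, the series `F_i` satisfy `F_i = 1 + y^(choose i K) (x
F_i + x² F_i F_(i+1))` (`weightGF_eq`).

For `i < K` the power of `y` is trivial, so `F_0` is a Möbius function of `F_K` with Chebyshev
coefficients (`weightGF_moebius`). Modulo `y^(K+2)` one may put `F_(K+1) = 1`, so `F_K` is `1 / (1 -
(x + x²) y)`. Then `F_0` is a ratio of two linear polynomials in `y` up to `y^(k-1)`, and its
coefficients from `y` onwards form a geometric progression (`exists_weightGF_zero`,
`innerCoeff_weightGF_succ`). -/

/-- Motzkin trees (unary-binary trees), with the leaves counted as empty. -/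
inductive MotzkinTree : Type
  | nil : MotzkinTree
  | one : MotzkinTree → MotzkinTree
  | two : MotzkinTree → MotzkinTree → MotzkinTree
  deriving DecidableEq

namespace MotzkinTree

/-- The length of the Motzkin permutation that is encoded by a tree. -/
def size : MotzkinTree → ℕ
  | nil => 0
  | one τ => size τ + 1
  | two σ τ => size σ + size τ + 2

/-- The Motzkin permutation of `off, …, off + size - 1` that is encoded by a tree. -/
def word : MotzkinTree → ℕ → List ℕ
  | nil, _ => []
  | one τ, off => (off + τ.size) :: word τ off
  | two σ τ, off =>
      word σ (off + τ.size + 1) ++ (off + τ.size) :: (off + τ.size + σ.size + 1) :: word τ off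

end MotzkinTree

/-! ### Pattern counts and avoidance under the two ways of concatenating words. -/

namespace List

/-- The number of increasing subsequences of length `j` all of whose letters exceed `a`. -/
def incCount : ℕ → ℕ → List ℕ → ℕ
  | 0, _, _ => 1
  | _ + 1, _, [] => 0
  | j + 1, a, b :: l => incCount (j + 1) a l + if a < b then incCount j b l else 0

/-- The number of occurrences of the pattern `21-3-⋯-(j + 2)` in the word, followed by a
letter smaller than all others. -/
def descCount (j : ℕ) : List ℕ → ℕ
  | [] => 0
  | [b] => incCount j b []
  | b :: c :: l => descCount j (c :: l) + if c < b then incCount j b l else 0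

/-- The word avoids the pattern `1-23`. -/
def AvoidsLateAscent : List ℕ → Prop
  | [] => True
  | a :: l => l.IsChain (fun b c => ¬ (a < b ∧ b < c)) ∧ AvoidsLateAscent l

/-- The word avoids `132` and `1-23`. -/
def IsMotzkinWord (l : List ℕ) : Prop :=
  l.Triplewise (fun a b c => ¬ (a < c ∧ c < b)) ∧ l.AvoidsLateAscent

theorem incCount_append_of_lt (A B : List ℕ) (j a : ℕ) (ha : ∀ b ∈ B, b < a)
    (h : ∀ x ∈ A, ∀ b ∈ B, b < x) : incCount j a (A ++ B) = incCount j a A := by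
  induction A generalizing j a with
  | nil =>
    induction B with
    | nil => rfl
    | cons b B ih =>
      cases j with
      | zero => simp [incCount]
      | succ j =>
        have := ih (by grind) (by simp)
        have hb : ¬ a < b := (ha b (by simp)).le.not_gt
        simpa [incCount, hb] using this
  | cons x A ih =>
    cases j with
    | zero => simp [incCount]
    | succ j =>
      simp only [cons_append, incCount]
      rw [ih _ _ ha fun y hy => h y (by simp [hy]), ih _ _ (h x (by simp)) fun y hy => h y (by simp [hy])]

/-- The letter `m` is too small to be used, and `M` can be the last letter of any increasing
subsequence of `A`. -/
theorem incCount_append_pair (A : List ℕ) (j a m M : ℕ) (hm : m < a) (hM : a < M)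
    (hA : ∀ x ∈ A, m < x ∧ x < M) :
    incCount (j + 1) a (A ++ [m, M]) = incCount (j + 1) a A + incCount j a A := by
  induction A generalizing j a with
  | nil =>
    have : ¬ a < m := by omega
    cases j <;> simp [incCount, hM, this]
  | cons x A ih =>
    have hx := hA x (by simp)
    have hA' : ∀ y ∈ A, m < y ∧ y < M := by grind
    cases j with
    | zero =>
      simp only [cons_append, incCount]
      rw [ih _ _ hm hM hA']
      simp only [incCount]
      omega
    | succ j =>
      simp only [cons_append, incCount]
      rw [ih _ _ hm hM hA', ih _ _ hx.1 hx.2 hA']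
      split <;> omega

theorem descCount_append_of_lt (A B : List ℕ) (j : ℕ) (h : ∀ x ∈ A, ∀ b ∈ B, b < x) :
    descCount j (A ++ B) = descCount j A + descCount j B := by
  induction A with
  | nil => simp [descCount]
  | cons x A ih =>
    have ih := ih (by grind)
    cases A with
    | nil =>
      cases B with
      | nil => simp [descCount]
      | cons b B =>
        have hb : b < x := h x (by simp) b (by simp)
        have := incCount_append_of_lt [] B j x (by grind) (by simp)
        simp only [nil_append] at this
        simp [descCount, hb, this]
        omega
    | cons y A =>
      simp only [cons_append, descCount] at ih ⊢
      rw [ih, incCount_append_of_lt A B j x (h x (by simp)) fun z hz => h z (by simp [hz])]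
      omega

/-- The letter `m` plays the role of the imagined small letter after `A`, so an occurrence ending in
`M` is a shorter one in `A`, including one whose descent leads to that imagined letter. -/
theorem descCount_succ_append_pair (A : List ℕ) (j m M : ℕ) (hm : m < M)
    (hA : ∀ x ∈ A, m < x ∧ x < M) :
    descCount (j + 1) (A ++ [m, M]) = descCount (j + 1) A + descCount j A := by
  have h0 : ¬ M < m := by omega
  induction A with
  | nil => simp [descCount, incCount, h0]
  | cons x A ih =>
    have ih := ih (by grind)
    have hx := hA x (by simp)
    have hi := fun A' h => incCount_append_pair A' j x m M hx.1 hx.2 h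
    cases A with
    | nil =>
      have := hi [] (by simp)
      cases j <;> simp_all [descCount, incCount]
    | cons y A =>
      simp only [cons_append, descCount] at ih ⊢
      rw [ih, hi A (by grind)]
      split <;> omega

/-- The new descent goes from `M` to the imagined final letter; the one into `m` was already counted
at the end of `A`, if `A` is nonempty. -/
theorem descCount_zero_append_pair (A : List ℕ) (m M : ℕ) (hm : m < M)
    (hA : ∀ x ∈ A, m < x ∧ x < M) :
    descCount 0 (A ++ [m, M]) = descCount 0 A + 1 := by
  have h0 : ¬ M < m := by omega
  induction A with
  | nil => simp [descCount, incCount, h0]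
  | cons x A ih =>
    have ih := ih (by grind)
    have hx := hA x (by simp)
    cases A with
    | nil => simp_all [descCount, incCount]
    | cons y A =>
      simp only [cons_append, descCount, incCount] at ih ⊢
      rw [ih]
      omega

theorem avoidsLateAscent_append (A B : List ℕ) (hA : A.AvoidsLateAscent) (hB : B.AvoidsLateAscent)
    (h : ∀ x ∈ A, ∀ b ∈ B, b < x) : (A ++ B).AvoidsLateAscent := by
  induction A with
  | nil => simpa
  | cons a A ih =>
    refine ⟨isChain_append.2 ⟨hA.1, ?_, ?_⟩, ih hA.2 (by grind)⟩
    · refine Pairwise.isChain (pairwise_iff_forall_sublist.2 fun {b c} hbc => ?_)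
      have := h a (by simp) b (hbc.subset (by simp))
      omega
    · intro x hx y hy
      have := h x (by simp [mem_of_mem_getLast? hx]) y (mem_of_mem_head? hy)
      omega

theorem avoidsLateAscent_append_pair (A : List ℕ) (m M : ℕ) (hA : A.AvoidsLateAscent)
    (h : ∀ x ∈ A, m < x) : (A ++ [m, M]).AvoidsLateAscent := by
  induction A with
  | nil => simp [AvoidsLateAscent]
  | cons a A ih =>
    have ha := h a (by simp)
    refine ⟨isChain_append.2 ⟨hA.1, by simp; omega, ?_⟩, ih hA.2 (by grind)⟩
    intro x hx y hy
    have := h x (by simp [mem_of_mem_getLast? hx])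
    simp at hy
    omega

theorem AvoidsLateAscent.of_append (A B : List ℕ) (h : (A ++ B).AvoidsLateAscent) :
    A.AvoidsLateAscent ∧ B.AvoidsLateAscent := by
  induction A with
  | nil => exact ⟨trivial, h⟩
  | cons a A ih => exact ⟨⟨(isChain_append.1 h.1).1, (ih h.2).1⟩, (ih h.2).2⟩

theorem AvoidsLateAscent.not_lt (A B : List ℕ) (m M : ℕ)
    (h : (A ++ m :: M :: B).AvoidsLateAscent) (hm : m < M) : ∀ a ∈ A, ¬ a < m := by
  induction A with
  | nil => simp
  | cons x A ih =>
    intro a ha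
    rcases mem_cons.1 ha with rfl | ha
    · have := (isChain_append_cons_cons.1 h.1).2.1
      omega
    · exact ih h.2 a ha

/-- Splitting a permutation of an interval into its large and its small letters. -/
theorem perm_range'_of_append (A B : List ℕ) (off n : ℕ) (h : A ++ B ~ range' off n)
    (hlt : ∀ x ∈ A, ∀ b ∈ B, b < x) :
    A ~ range' (off + B.length) A.length ∧ B ~ range' off B.length := by
  have hn : n = B.length + A.length := by
    have := h.length_eq
    simp at this
    omega
  -- Sorting both blocks and putting the small one first gives a sorted permutation of the interval,
  -- hence the interval itself.
  have e : B.mergeSort (· ≤ ·) ++ A.mergeSort (· ≤ ·) = range' off n := by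
    refine Perm.eq_of_pairwise (le := (· ≤ ·)) (fun a b _ _ h1 h2 => le_antisymm h1 h2) ?_ ?_ ?_
    · refine pairwise_append.2 ⟨?_, ?_, fun a ha b hb => ?_⟩
      · simpa using pairwise_mergeSort (le := fun a b : ℕ => decide (a ≤ b))
          (by simpa using fun a b c => le_trans) (by simpa using le_total) B
      · simpa using pairwise_mergeSort (le := fun a b : ℕ => decide (a ≤ b))
          (by simpa using fun a b c => le_trans) (by simpa using le_total) A
      · exact (hlt b (mem_mergeSort.1 hb) a (mem_mergeSort.1 ha)).le
    · exact (pairwise_lt_range' (s := off) (n := n)).imp le_of_lt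
    · exact (((mergeSort_perm B _).append (mergeSort_perm A _)).trans perm_append_comm).trans h
  rw [hn, ← range'_append_1] at e
  obtain ⟨h1, h2⟩ := append_inj e (by simp)
  exact ⟨h2 ▸ (mergeSort_perm A _).symm, h1 ▸ (mergeSort_perm B _).symm⟩

end List

/-! ### The bijection between trees and Motzkin words. -/

namespace MotzkinTree

section

open List

theorem word_perm (t : MotzkinTree) (off : ℕ) : t.word off ~ range' off t.size := by
  induction t generalizing off with
  | nil => simp [word, size]
  | one τ ih =>
    simp only [word, size]
    rw [range'_1_concat]
    exact ((ih off).cons _).trans (perm_append_singleton _ _).symm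
  | two σ τ ihσ ihτ =>
    simp only [word, size]
    have e : range' off (σ.size + τ.size + 2) = range' off τ.size ++ ((off + τ.size) ::
        (range' (off + τ.size + 1) σ.size ++ [off + τ.size + σ.size + 1])) := by
      rw [show off + τ.size + σ.size + 1 = (off + τ.size + 1) + σ.size by ring,
        ← range'_1_concat, ← range'_succ, range'_append_1]
      congr 1
      ring
    rw [e]
    refine Perm.trans ?_ (((ihτ off).append ((((ihσ _).append_right _).cons _))))
    refine perm_iff_count.2 fun a => ?_
    simp only [count_append, count_cons]
    simp
    omega

theorem mem_word {t : MotzkinTree} {off x : ℕ} :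
    x ∈ t.word off ↔ off ≤ x ∧ x < off + t.size := by
  rw [(t.word_perm off).mem_iff, mem_range'_1]

theorem length_word (t : MotzkinTree) (off : ℕ) : (t.word off).length = t.size := by
  simpa using (t.word_perm off).length_eq

theorem word_two (σ τ : MotzkinTree) (off : ℕ) : (two σ τ).word off =
    (σ.word (off + τ.size + 1) ++ [off + τ.size, off + τ.size + σ.size + 1]) ++ τ.word off := by
  simp [word]

theorem word_injective {t t' : MotzkinTree} {off : ℕ} (h : t.word off = t'.word off) : t = t' := by
  have hs : t.size = t'.size := by rw [← length_word t off, h, length_word]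
  -- Equal sizes give equal largest letters, and each word can be cut uniquely at that letter;
  -- whether anything precedes it tells the two constructors apart.
  have cancel : ∀ {A A' B B' : List ℕ} {M M' : ℕ}, A ++ M :: B = A' ++ M' :: B' → M = M' → M ∉ A →
      M ∉ A' → A = A' ∧ B = B' := by
    intro A A' B B' M M' h hM h1 h2
    induction A generalizing A' with
    | nil => cases A' <;> grind
    | cons a A ih => cases A' <;> grind
  induction t generalizing off t' with
  | nil => cases t' <;> simp_all [size]
  | one τ ih =>
    cases t' with
    | nil => simp [size] at hs
    | one τ' =>
      simp only [size, word, cons.injEq] at h hs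
      rw [ih h.2 (by omega)]
    | two σ' τ' =>
      simp only [size] at hs
      have := cancel (A := []) (A' := σ'.word (off + τ'.size + 1) ++ [off + τ'.size])
        (by simpa [word] using h) (by omega) (by simp) (by simp [mem_word]; omega)
      simp at this
  | two σ τ ihσ ihτ =>
    cases t' with
    | nil => simp [size] at hs
    | one τ' =>
      simp only [size] at hs
      have := cancel (A' := []) (A := σ.word (off + τ.size + 1) ++ [off + τ.size])
        (by simpa [word] using h) (by omega) (by simp [mem_word]; omega) (by simp)
      simp at this
    | two σ' τ' =>
      simp only [size] at hs
      obtain ⟨h1, h2⟩ := cancel (A' := σ'.word (off + τ'.size + 1) ++ [off + τ'.size])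
        (A := σ.word (off + τ.size + 1) ++ [off + τ.size])
        (by simpa [word] using h) (by omega) (by simp [mem_word]; omega)
        (by simp [mem_word]; omega)
      have e : τ.size = τ'.size := by rw [← length_word τ off, h2, length_word]
      rw [ihτ h2 e]
      rw [e] at h1
      rw [ihσ (append_inj_left' h1 rfl) (by omega)]

theorem isMotzkinWord_word (t : MotzkinTree) (off : ℕ) : (t.word off).IsMotzkinWord := by
  induction t generalizing off with
  | nil => simp [word, List.IsMotzkinWord, AvoidsLateAscent]
  | one τ ih =>
    obtain ⟨h1, h2⟩ := ih off
    refine ⟨triplewise_cons.2 ⟨pairwise_iff_forall_sublist.2 fun {b c} hbc => ?_, h1⟩, ?_, h2⟩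
    · have := mem_word.1 (hbc.subset (a := c) (by simp))
      omega
    · refine Pairwise.isChain (pairwise_iff_forall_sublist.2 fun {b c} hbc => ?_)
      have := mem_word.1 (hbc.subset (a := b) (by simp))
      omega
  | two σ τ ihσ ihτ =>
    obtain ⟨h1, h2⟩ := ihσ (off + τ.size + 1)
    obtain ⟨h3, h4⟩ := ihτ off
    rw [word_two]
    have hlt : ∀ x ∈ σ.word (off + τ.size + 1) ++ [off + τ.size, off + τ.size + σ.size + 1],
        ∀ b ∈ τ.word off, b < x := by
      simp only [mem_append, mem_word, mem_cons, not_mem_nil, or_false]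
      omega
    refine ⟨triplewise_append.2 ⟨triplewise_append.2 ⟨h1, by simp, ?_, ?_⟩, h3, ?_, ?_⟩,
      avoidsLateAscent_append _ _ (avoidsLateAscent_append_pair _ _ _ h2 ?_) h4 hlt⟩
    · simp only [mem_word, pairwise_pair]
      omega
    · intro a ha
      refine pairwise_iff_forall_sublist.2 fun {b c} hbc => ?_
      have := mem_word.1 (hbc.subset (a := c) (by simp))
      have := mem_word.1 (hbc.subset (a := b) (by simp))
      simp at ha
      omega
    · intro a ha
      refine pairwise_iff_forall_sublist.2 fun {b c} hbc => ?_
      have := hlt a ha c (hbc.subset (by simp))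
      omega
    · intro a ha
      refine pairwise_iff_forall_sublist.2 fun {b c} hbc => ?_
      have := hlt b (hbc.subset (by simp)) a ha
      omega
    · simp only [mem_word]
      omega

theorem exists_word_eq (n off : ℕ) (l : List ℕ) (hl : l ~ range' off n) (hM : l.IsMotzkinWord) :
    ∃ t : MotzkinTree, t.size = n ∧ t.word off = l := by
  induction n using Nat.strong_induction_on generalizing off l with
  | _ n ih =>
  rcases Nat.eq_zero_or_pos n with rfl | hn
  · exact ⟨nil, rfl, by simpa [word] using hl.symm⟩
  have hnd : l.Nodup := hl.nodup_iff.2 nodup_range'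
  have hmem : ∀ x ∈ l, off ≤ x ∧ x < off + n := fun x hx => by
    simpa using mem_range'_1.1 (hl.mem_iff.1 hx)
  obtain ⟨A, B, rfl⟩ := append_of_mem
    (hl.mem_iff.2 (mem_range'_1.2 ⟨by omega, by omega⟩) : off + n - 1 ∈ l)
  set M := off + n - 1 with hMdef
  have hMA : M ∉ A ∧ M ∉ B := by simpa using (nodup_cons.1 (perm_middle.nodup_iff.1 hnd)).1
  have hlen : n = A.length + B.length + 1 := by
    have := hl.length_eq
    simp at this
    omega
  -- Otherwise `x`, `M`, `b` would form a 132.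
  have hAB : ∀ x ∈ A, ∀ b ∈ B, b < x := by
    intro x hx b hb
    have : x ≠ b := (nodup_append.1 hnd).2.2 x hx b (by simp [hb])
    have h1 := (pairwise_cons.1 ((triplewise_append.1 hM.1).2.2.1 x hx)).1 b hb
    have : b ≠ M := fun h => hMA.2 (h ▸ hb)
    have := hmem b (by simp [hb])
    omega
  have hperm : A ++ B ~ range' off (n - 1) := by
    have h1 : range' off n = range' off (n - 1) ++ [M] := by
      rw [hMdef, show off + n - 1 = off + (n - 1) by omega, ← range'_1_concat]
      congr 1
      omega
    rw [h1] at hl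
    exact (perm_middle.symm.trans (hl.trans (perm_append_singleton _ _))).cons_inv
  obtain ⟨hA, hB⟩ := perm_range'_of_append A B off _ hperm hAB
  have hmA : A.IsMotzkinWord := ⟨(triplewise_append.1 hM.1).1, (hM.2.of_append).1⟩
  have hmB : B.IsMotzkinWord := ⟨(triplewise_cons.1 (triplewise_append.1 hM.1).2.1).2, (hM.2.of_append).2.2⟩
  obtain ⟨τ, hτ, rfl⟩ := ih B.length (by omega) off B hB hmB
  rcases A.eq_nil_or_concat with rfl | ⟨A, m, rfl⟩
  · refine ⟨one τ, ?_, ?_⟩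
    · simp [size, hlen, hτ]
    · have : M = off + τ.size := by simp at hlen; omega
      simp [word, this]
  · have hm : m < M := by
      have := hmem m (by simp)
      have : m ≠ M := fun h => hMA.1 (by simp [h])
      omega
    -- Otherwise `x` and the ascent `m M` would form a 1-23.
    have hAm : ∀ x ∈ A, ∀ b ∈ [m], b < x := by
      intro x hx b hb
      have h0 := hM.2
      simp only [append_assoc, singleton_append, concat_eq_append] at h0
      have h1 := h0.not_lt _ _ _ _ hm x hx
      have : x ≠ m := (nodup_append.1 (by simpa using (nodup_append.1 hnd).1)).2.2 x hx m (by simp)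
      simp at hb
      omega
    obtain ⟨h1, h2⟩ := perm_range'_of_append A [m] _ _ (by simpa using hA) hAm
    have h2 : m = off + τ.size := by simpa [hτ] using h2
    rw [length_word] at h1
    obtain ⟨σ, hσ, rfl⟩ := ih A.length (by simp at hlen; omega) _ A h1
      ⟨(triplewise_append.1 (by simpa using hmA.1)).1, (AvoidsLateAscent.of_append A [m] (by simpa using hmA.2)).1⟩
    refine ⟨two σ τ, ?_, ?_⟩
    · simp [size, hlen, length_word]
      omega
    · have : M = off + τ.size + σ.size + 1 := by simp [length_word] at hlen; omega
      simp [word, this, h2]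

/-! ### The binomially weighted statistic on trees. -/

/-- The weighted pattern count that satisfies a recursion along the tree. -/
def weight (K : ℕ) : ℕ → MotzkinTree → ℕ
  | _, nil => 0
  | i, one τ => weight K i τ + i.choose K
  | i, two σ τ => weight K i τ + weight K (i + 1) σ + i.choose K

/-- The binomial weights absorb the shift `d_j + d_(j-1)` by Pascal's rule, closing the recursion on
a single statistic indexed by `i`. -/
theorem sum_descCount_word (K i off : ℕ) (t : MotzkinTree) :
    ∑ j ∈ Finset.range (K + 1), i.choose (K - j) * descCount j (t.word off) = weight K i t := by
  induction t generalizing i off with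
  | nil => simp [word, weight, descCount]
  | one τ ih =>
    have h : ∀ j, descCount j ((one τ).word off) = descCount j (τ.word off) + if j = 0 then 1 else 0 := by
      intro j
      have := descCount_append_of_lt [off + τ.size] (τ.word off) j (by simp [mem_word])
      simp only [word]
      rw [← singleton_append, this, add_comm]
      cases j <;> simp [descCount, incCount]
    simp only [h, mul_add, Finset.sum_add_distrib, ih, weight]
    simp
  | two σ τ ihσ ihτ =>
    have h : ∀ j, descCount j ((two σ τ).word off) = descCount j (τ.word off) +
        (descCount j (σ.word (off + τ.size + 1)) +
          if j = 0 then 1 else descCount (j - 1) (σ.word (off + τ.size + 1))) := by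
      intro j
      rw [word_two, descCount_append_of_lt _ _ _ (by
        simp only [mem_append, mem_word, mem_cons, not_mem_nil, or_false]; omega), add_comm]
      cases j with
      | zero =>
        rw [descCount_zero_append_pair _ _ _ (by omega) (by simp only [mem_word]; omega)]
        simp
      | succ j =>
        rw [descCount_succ_append_pair _ _ _ _ (by omega) (by simp only [mem_word]; omega)]
        simp
    simp only [h, mul_add, Finset.sum_add_distrib, ihτ, weight, add_assoc]
    rw [← ihσ (i + 1) (off + τ.size + 1)]
    congr 1
    conv_lhs => rw [Finset.sum_range_succ' (fun x => _ * ite _ _ _)]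
    simp only [Nat.add_eq_zero_iff, one_ne_zero, and_false, if_false, if_true, Nat.add_sub_cancel, mul_one,
      Nat.sub_zero, ← add_assoc]
    congr 1
    -- Pascal's rule handles the terms with `j < K`; the top term has coefficient 1 on both sides.
    rw [Finset.sum_range_succ, Finset.sum_range_succ _ K, add_right_comm, ← Finset.sum_add_distrib]
    congr 1
    · refine Finset.sum_congr rfl fun j hj => ?_
      have : K - j = (K - (j + 1)) + 1 := by have := Finset.mem_range.1 hj; omega
      rw [this, Nat.choose_succ_succ]
      ring
    · simp

end

end MotzkinTree

/-! ### Occurrences as sets of positions, counted by the recursive functions. -/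

namespace List

/-- Positions of the increasing subsequences of length `j` all of whose letters exceed `a`. -/
def incSet (j a : ℕ) (l : List ℕ) : Set (Fin j → ℕ) :=
  {i | StrictMono i ∧ StrictMono (fun t => l.getD (i t) 0) ∧
    ∀ t, i t < l.length ∧ a < l.getD (i t) 0}

/-- Positions of the occurrences of `21-3-⋯-(j + 2)`. -/
def descSet (j : ℕ) (l : List ℕ) : Set (Fin (j + 2) → ℕ) :=
  {i | i 1 = i 0 + 1 ∧ i 1 < l.length ∧ l.getD (i 1) 0 < l.getD (i 0) 0 ∧
    (∀ t : Fin j, i 1 < i t.succ.succ) ∧ (fun t : Fin j => i t.succ.succ) ∈ incSet j (l.getD (i 0) 0) l}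

theorem strictMono_fin_succ_iff {j : ℕ} {f : Fin (j + 1) → ℕ} :
    StrictMono f ↔ (∀ t : Fin j, f 0 < f t.succ) ∧ StrictMono (fun t : Fin j => f t.succ) := by
  refine ⟨fun h => ⟨fun t => h (Fin.succ_pos t), fun a b hab => h (Fin.succ_lt_succ_iff.2 hab)⟩,
    fun ⟨h1, h2⟩ a b => ?_⟩
  refine Fin.cases ?_ (fun a => ?_) a <;> refine Fin.cases ?_ (fun b => ?_) b
  · simp
  · exact fun _ => h1 b
  · simp
  · exact fun hab => h2 (Fin.succ_lt_succ_iff.1 hab)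

theorem mem_incSet_succ {j a : ℕ} {l : List ℕ} {i : Fin (j + 1) → ℕ} :
    i ∈ incSet (j + 1) a l ↔ i 0 < l.length ∧ a < l.getD (i 0) 0 ∧ (∀ t : Fin j, i 0 < i t.succ) ∧
      (fun t : Fin j => i t.succ) ∈ incSet j (l.getD (i 0) 0) l := by
  simp only [incSet, Set.mem_ofPred_eq, strictMono_fin_succ_iff (f := i),
    strictMono_fin_succ_iff (f := fun t => l.getD (i t) 0), Fin.forall_fin_succ (n := j)]
  constructor
  · rintro ⟨⟨h1, h2⟩, ⟨h3, h4⟩, ⟨h5, h6⟩, h7⟩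
    exact ⟨h5, h6, h1, h2, h4, fun t => ⟨(h7 t).1, h3 t⟩⟩
  · rintro ⟨h5, h6, h1, h2, h4, h7⟩
    exact ⟨⟨h1, h2⟩, ⟨fun t => (h7 t).2, h4⟩, ⟨h5, h6⟩, fun t => ⟨(h7 t).1, h6.trans (h7 t).2⟩⟩

theorem add_one_mem_incSet_cons {j a b : ℕ} {l : List ℕ} {i : Fin j → ℕ} :
    (fun t => i t + 1) ∈ incSet j a (b :: l) ↔ i ∈ incSet j a l := by
  simp [incSet, StrictMono]

theorem exists_eq_add_one {j : ℕ} {i : Fin j → ℕ} (h : ∀ t, 0 < i t) :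
    ∃ i' : Fin j → ℕ, i = fun t => i' t + 1 :=
  ⟨fun t => i t - 1, funext fun t => (Nat.sub_add_cancel (h t)).symm⟩

theorem add_one_injective (j : ℕ) :
    Function.Injective (fun (i : Fin j → ℕ) t => i t + 1) := fun i i' h => by
  funext t
  simpa using congrFun h t

/-- The two pieces are the subsequences that skip the head and those that start with it, matching
the recursion of `incCount`. -/
theorem incSet_succ_cons (j a b : ℕ) (l : List ℕ) : incSet (j + 1) a (b :: l) =
    (fun i t => i t + 1) '' incSet (j + 1) a l ∪
      if a < b then (fun i : Fin j → ℕ => (Fin.cons 0 (fun t => i t + 1) : Fin (j + 1) → ℕ)) ''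
        incSet j b l else ∅ := by
  ext i
  constructor
  · intro hi
    have h := mem_incSet_succ.1 hi
    rcases Nat.eq_zero_or_pos (i 0) with h0 | h0
    · right
      rw [h0] at h
      simp only [getD_cons_zero] at h
      obtain ⟨i', hi'⟩ := exists_eq_add_one h.2.2.1
      rw [if_pos h.2.1]
      refine ⟨i', add_one_mem_incSet_cons.1 (hi' ▸ h.2.2.2), ?_⟩
      funext t
      refine Fin.cases h0.symm (fun t => ?_) t
      simpa using (congrFun hi' t).symm
    · left
      obtain ⟨i', rfl⟩ := exists_eq_add_one (i := i) (fun t => h0.trans_le (hi.1.monotone (Fin.zero_le t)))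
      exact ⟨i', add_one_mem_incSet_cons.1 hi, rfl⟩
  · rintro (⟨i', hi', rfl⟩ | h)
    · exact add_one_mem_incSet_cons.2 hi'
    · split_ifs at h with hab
      · obtain ⟨i', hi', rfl⟩ := h
        refine mem_incSet_succ.2 ?_
        simpa [hab] using add_one_mem_incSet_cons.2 hi'
      · exact h.elim

theorem finite_and_ncard_incSet (j a : ℕ) (l : List ℕ) :
    (incSet j a l).Finite ∧ (incSet j a l).ncard = incCount j a l := by
  induction l generalizing j a with
  | nil =>
    cases j with
    | zero =>
      refine ⟨Set.toFinite _, ?_⟩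
      rw [incCount, Set.ncard_eq_one]
      exact ⟨Fin.elim0, Set.eq_singleton_iff_unique_mem.2
        ⟨⟨fun a => a.elim0, fun a => a.elim0, fun a => a.elim0⟩, fun _ _ => Subsingleton.elim _ _⟩⟩
    | succ j =>
      have : incSet (j + 1) a [] = ∅ := by
        ext i
        simp [mem_incSet_succ]
      simp [this, incCount]
  | cons b l ih =>
    cases j with
    | zero =>
      refine ⟨Set.toFinite _, ?_⟩
      rw [incCount, Set.ncard_eq_one]
      exact ⟨Fin.elim0, Set.eq_singleton_iff_unique_mem.2
        ⟨⟨fun a => a.elim0, fun a => a.elim0, fun a => a.elim0⟩, fun _ _ => Subsingleton.elim _ _⟩⟩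
    | succ j =>
      rw [incSet_succ_cons]
      obtain ⟨f1, n1⟩ := ih (j + 1) a
      obtain ⟨f2, n2⟩ := ih j b
      have e1 := Set.ncard_image_of_injective (incSet (j + 1) a l) (add_one_injective (j + 1))
      split_ifs with hab
      · have inj : Function.Injective
            (fun i : Fin j → ℕ => (Fin.cons 0 (fun t => i t + 1) : Fin (j + 1) → ℕ)) :=
          (Fin.cons_right_injective (α := fun _ => ℕ) 0).comp (add_one_injective j)
        refine ⟨(f1.image _).union (f2.image _), ?_⟩
        rw [Set.ncard_union_eq ?_ (f1.image _) (f2.image _), e1, Set.ncard_image_of_injective _ inj,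
          n1, n2, incCount, if_pos hab]
        rw [Set.disjoint_left]
        rintro _ ⟨i, -, rfl⟩ ⟨i', -, h⟩
        simpa using congrFun h 0
      · rw [Set.union_empty]
        exact ⟨f1.image _, by rw [e1, n1, incCount, if_neg hab, add_zero]⟩

theorem add_one_mem_descSet_cons {j b : ℕ} {l : List ℕ} {i : Fin (j + 2) → ℕ} :
    (fun t => i t + 1) ∈ descSet j (b :: l) ↔ i ∈ descSet j l := by
  have h := @add_one_mem_incSet_cons j (l.getD (i 0) 0) b l (fun t => i t.succ.succ)
  simp only [descSet, Set.mem_ofPred_eq, length_cons, getD_cons_succ, h]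
  simp

theorem descSet_cons_cons (j b c : ℕ) (l : List ℕ) : descSet j (b :: c :: l) =
    (fun i t => i t + 1) '' descSet j (c :: l) ∪
      if c < b then (fun i : Fin j → ℕ =>
        (Fin.cons 0 (Fin.cons 1 (fun t => i t + 1 + 1) : Fin (j + 1) → ℕ) : Fin (j + 2) → ℕ)) ''
        incSet j b l else ∅ := by
  ext i
  constructor
  · intro hi
    obtain ⟨h1, h2, h3, h4, h5⟩ := hi
    rcases Nat.eq_zero_or_pos (i 0) with h0 | h0
    · right
      rw [h0] at h1 h3 h5
      rw [h1] at h3 h4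
      have h3 : c < b := by simpa using h3
      rw [if_pos h3]
      obtain ⟨i', hi'⟩ := exists_eq_add_one (i := fun t : Fin j => i t.succ.succ)
        (fun t => by have := h4 t; omega)
      obtain ⟨i'', hi''⟩ := exists_eq_add_one (i := i')
        (fun t => by have := h4 t; have : i t.succ.succ = i' t + 1 := congrFun hi' t; omega)
      subst hi''
      rw [hi', add_one_mem_incSet_cons, add_one_mem_incSet_cons] at h5
      refine ⟨i'', h5, ?_⟩
      funext t
      refine Fin.cases h0.symm (fun t => Fin.cases ?_ (fun t => ?_) t) t
      · simpa using h1.symm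
      · simpa using (congrFun hi' t).symm
    · left
      obtain ⟨i', rfl⟩ := exists_eq_add_one (i := i) (Fin.cases h0 (Fin.cases (by simp [h1])
        (fun t => by have := h4 t; omega)))
      exact ⟨i', add_one_mem_descSet_cons.1 ⟨h1, h2, h3, h4, h5⟩, rfl⟩
  · rintro (⟨i', hi', rfl⟩ | h)
    · exact add_one_mem_descSet_cons.2 hi'
    · split_ifs at h with hab
      · obtain ⟨i', hi', rfl⟩ := h
        have h5 := add_one_mem_incSet_cons (b := b).2 (add_one_mem_incSet_cons (b := c).2 hi')
        have e1 : ∀ f : Fin (j + 1) → ℕ, (Fin.cons 0 f : Fin (j + 2) → ℕ) 1 = f 0 := fun f => rfl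
        refine ⟨?_, ?_, ?_, ?_, ?_⟩
        · simp [e1]
        · simp [e1]
        · simpa [e1] using hab
        · simp [e1]
        · simpa using h5
      · exact h.elim

/-- For `j = 0` the imagined final letter would add one to the count of a nonempty word; for `j ≠ 0`
nothing can follow it, so it contributes nothing. -/
theorem finite_and_ncard_descSet (j : ℕ) (hj : j ≠ 0) (l : List ℕ) :
    (descSet j l).Finite ∧ (descSet j l).ncard = descCount j l := by
  induction l with
  | nil =>
    have : descSet j [] = ∅ := by
      ext i
      simp [descSet]
    simp [this, descCount]
  | cons b l ih =>
    cases l with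
    | nil =>
      have : descSet j [b] = ∅ := by
        ext i
        simp only [descSet, length_singleton, Set.mem_ofPred_eq, Set.mem_empty_iff_false, iff_false]
        omega
      obtain ⟨j, rfl⟩ := Nat.exists_eq_succ_of_ne_zero hj
      simp [this, descCount, incCount]
    | cons c l =>
      rw [descSet_cons_cons]
      obtain ⟨f1, n1⟩ := ih
      obtain ⟨f2, n2⟩ := finite_and_ncard_incSet j b l
      have e1 := Set.ncard_image_of_injective (descSet j (c :: l)) (add_one_injective (j + 2))
      split_ifs with hab
      · have inj : Function.Injective (fun i : Fin j → ℕ =>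
            (Fin.cons 0 (Fin.cons 1 (fun t => i t + 1 + 1) : Fin (j + 1) → ℕ) : Fin (j + 2) → ℕ)) :=
          (Fin.cons_right_injective (α := fun _ => ℕ) 0).comp
            ((Fin.cons_right_injective (α := fun _ => ℕ) 1).comp
              ((add_one_injective j).comp (add_one_injective j)))
        refine ⟨(f1.image _).union (f2.image _), ?_⟩
        rw [Set.ncard_union_eq ?_ (f1.image _) (f2.image _), e1, Set.ncard_image_of_injective _ inj,
          n1, n2, descCount, if_pos hab]
        rw [Set.disjoint_left]
        rintro _ ⟨i, -, rfl⟩ ⟨i', -, h⟩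
        simpa using congrFun h 0
      · rw [Set.union_empty]
        exact ⟨f1.image _, by rw [e1, n1, descCount, if_neg hab, add_zero]⟩

theorem avoidsLateAscent_iff_getElem {l : List ℕ} : l.AvoidsLateAscent ↔
    ∀ a b : ℕ, ∀ hab : a < b, ∀ hb : b + 1 < l.length, ¬ (l[a] < l[b] ∧ l[b] < l[b + 1]) := by
  induction l with
  | nil => simp [AvoidsLateAscent]
  | cons x l ih =>
    rw [AvoidsLateAscent, ih, isChain_iff_getElem]
    constructor
    · rintro ⟨h1, h2⟩ a b hab hb
      obtain ⟨b, rfl⟩ := Nat.exists_eq_add_of_lt (Nat.zero_le a |>.trans_lt hab)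
      simp only [zero_add] at *
      cases a with
      | zero => simpa using h1 b (by simpa using hb)
      | succ a => simpa using h2 a b (by omega) (by simpa using hb)
    · refine fun h => ⟨fun b hb => ?_, fun a b hab hb => ?_⟩
      · simpa using! h 0 (b + 1) (by omega) (by simpa using hb)
      · simpa using! h (a + 1) (b + 1) (by omega) (by simpa using hb)

end List

/-! ### From permutations to words. -/

/-- The word `π₁ ⋯ πₙ` of a permutation of `0, …, n - 1`. -/
def Equiv.Perm.toWord {n : ℕ} (π : Equiv.Perm (Fin n)) : List ℕ :=
  List.ofFn fun i => (π i : ℕ)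

section

open List

theorem Equiv.Perm.toWord_getD {n : ℕ} (π : Equiv.Perm (Fin n)) (i : Fin n) :
    π.toWord.getD i 0 = π i := by
  simp [toWord]

theorem Equiv.Perm.length_toWord {n : ℕ} (π : Equiv.Perm (Fin n)) : π.toWord.length = n := by
  simp [toWord]

theorem avoids_pattern132_iff {n : ℕ} (π : Equiv.Perm (Fin n)) :
    Avoids pattern132 π ↔ π.toWord.Triplewise (fun a b c => ¬ (a < c ∧ c < b)) := by
  rw [triplewise_iff_getElem]
  simp only [Equiv.Perm.toWord, length_ofFn, List.getElem_ofFn, Fin.val_fin_lt]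
  constructor
  · intro h a b c hab hbc hc hlt
    refine h ![⟨a, by omega⟩, ⟨b, by omega⟩, ⟨c, hc⟩] ⟨?_, ?_, by simp [pattern132]⟩
    · intro x y hxy
      fin_cases x <;> fin_cases y <;> simp at hxy ⊢ <;> omega
    · intro x y
      fin_cases x <;> fin_cases y <;> simp [pattern132] <;> omega
  · rintro h i ⟨h1, h2, -⟩
    refine h (i 0) (i 1) (i 2) (h1 (by decide)) (h1 (by decide)) (i 2).2 ⟨?_, ?_⟩
    · exact (h2 0 2).2 (by simp [pattern132])
    · exact (h2 2 1).2 (by simp [pattern132])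

theorem avoids_pattern1d23_iff {n : ℕ} (π : Equiv.Perm (Fin n)) :
    Avoids pattern1d23 π ↔ π.toWord.AvoidsLateAscent := by
  rw [avoidsLateAscent_iff_getElem]
  simp only [Equiv.Perm.toWord, length_ofFn, List.getElem_ofFn, Fin.val_fin_lt]
  constructor
  · intro h a b hab hb hlt
    refine h ![⟨a, by omega⟩, ⟨b, by omega⟩, ⟨b + 1, hb⟩] ⟨?_, ?_, ?_⟩
    · intro x y hxy
      fin_cases x <;> fin_cases y <;> simp at hxy ⊢ <;> omega
    · intro x y
      fin_cases x <;> fin_cases y <;> simp [pattern1d23] <;> omega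
    · intro x y
      fin_cases x <;> fin_cases y <;> simp [pattern1d23]
  · rintro h i ⟨h1, h2, h3⟩
    have e : (i 2 : ℕ) = i 1 + 1 := h3 1 2 rfl (by simp [pattern1d23])
    have e' : (⟨i 1 + 1, e ▸ (i 2).2⟩ : Fin n) = i 2 := Fin.ext e.symm
    refine h (i 0) (i 1) (h1 (by decide)) (e ▸ (i 2).2) ⟨?_, ?_⟩
    · exact (h2 0 1).2 (by simp [pattern1d23])
    · rw [e']
      exact (h2 1 2).2 (by simp [pattern1d23])

theorem isMotzkin_iff_toWord {n : ℕ} (π : Equiv.Perm (Fin n)) :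
    IsMotzkin π ↔ π.toWord.IsMotzkinWord := by
  rw [IsMotzkin, List.IsMotzkinWord, avoids_pattern132_iff, avoids_pattern1d23_iff]

theorem isOccurrence_pattern21d_iff {n j : ℕ} (π : Equiv.Perm (Fin n)) (i : Fin (j + 2) → Fin n) :
    IsOccurrence (pattern21d (j + 2)) π i ↔ (fun t => (i t : ℕ)) ∈ descSet j π.toWord := by
  have e2 : ∀ t : Fin j, (pattern21d (j + 2)).letter t.succ.succ = t + 3 := fun t => by
    simp [pattern21d]
  have e0 : (pattern21d (j + 2)).letter 0 = 2 := rfl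
  have e1 : (pattern21d (j + 2)).letter 1 = 1 := rfl
  have s1 : ((0 : Fin (j + 1)).succ) = 1 := rfl
  have cases : ∀ {P : Fin (j + 2) → Prop}, P 0 → P 1 → (∀ t : Fin j, P t.succ.succ) → ∀ a, P a :=
    fun h0 h1 h => Fin.cases h0 (Fin.cases h1 h)
  simp only [descSet, incSet, Set.mem_ofPred_eq, π.toWord_getD, π.length_toWord, Fin.val_fin_lt]
  constructor
  · rintro ⟨h1, h2, h3⟩
    refine ⟨h3 0 1 rfl (by simp [pattern21d]), (i 1).2, (h2 1 0).2 (by simp [e0, e1]), fun t => h1 ?_,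
      fun a b hab => h1 ?_, fun a b hab => ?_, fun t => ⟨(i _).2, (h2 _ _).2 (by simp [e0, e2])⟩⟩
    · rw [← s1]
      exact Fin.succ_lt_succ_iff.2 (Fin.succ_pos t)
    · exact Fin.succ_lt_succ_iff.2 (Fin.succ_lt_succ_iff.2 hab)
    · exact (h2 _ _).2 (by simpa [e2] using hab)
  · rintro ⟨h1, -, h3, h4, h5, h6, h7⟩
    refine ⟨?_, ?_, ?_⟩
    · refine strictMono_fin_succ_iff (f := fun t => (i t : ℕ)).2 ⟨Fin.cases ?_ fun t => ?_,
        strictMono_fin_succ_iff.2 ⟨h4, h5⟩⟩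
      · show (i 0 : ℕ) < i 1
        omega
      · have := Fin.lt_def.1 (h4 t)
        omega
    -- One implication, together with distinct pattern letters, gives the equivalence by trichotomy.
    · have mono : ∀ a b, (pattern21d (j + 2)).letter a < (pattern21d (j + 2)).letter b →
          π (i a) < π (i b) := by
        refine cases (cases (by simp) ?_ fun b => ?_) (cases ?_ (by simp) fun b => ?_)
          fun a => cases ?_ ?_ fun b => ?_
        · simp [e0, e1]
        · exact fun _ => (h7 b).2
        · exact fun _ => h3
        · exact fun _ => h3.trans (h7 b).2
        · simp [e0, e2]
        · simp [e1, e2]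
        · intro hab
          exact h6 (by simpa [e2] using hab)
      have inj : ∀ a b, (pattern21d (j + 2)).letter a = (pattern21d (j + 2)).letter b → a = b := by
        refine cases (cases (by simp) ?_ fun b => ?_) (cases ?_ (by simp) fun b => ?_)
          fun a => cases ?_ ?_ fun b => ?_
        · simp [e0, e1]
        · simp [e0, e2]
        · simp [e0, e1]
        · simp [e1, e2]
        · simp [e0, e2]
        · simp [e1, e2]
        · simp [e2, Fin.ext_iff]
      intro a b
      refine ⟨fun h => ?_, mono a b⟩
      rcases lt_trichotomy ((pattern21d (j + 2)).letter a) ((pattern21d (j + 2)).letter b) with h' | h' | h'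
      · exact h'
      · exact absurd h (inj a b h' ▸ lt_irrefl _)
      · exact absurd h (mono b a h').not_gt
    · intro a b hab ha
      have ha : a = 0 := Fin.ext (by simpa [pattern21d] using ha)
      subst ha
      have : b = 1 := Fin.ext (by simpa using hab)
      subst this
      exact h1

theorem numOccurrences_pattern21d {n j : ℕ} (hj : j ≠ 0) (π : Equiv.Perm (Fin n)) :
    numOccurrences (pattern21d (j + 2)) π = descCount j π.toWord := by
  rw [← (finite_and_ncard_descSet j hj π.toWord).2, numOccurrences]
  have inj : Function.Injective (fun (i : Fin (j + 2) → Fin n) t => (i t : ℕ)) :=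
    fun i i' h => funext fun t => Fin.ext (congrFun h t)
  rw [← Set.ncard_image_of_injective _ inj]
  congr 1
  ext i
  constructor
  · rintro ⟨i, hi, rfl⟩
    exact (isOccurrence_pattern21d_iff π i).1 hi
  · intro hi
    have hlt : ∀ t, i t < n := by
      have hl := π.length_toWord
      obtain ⟨h1, h2, -, -, h5⟩ := hi
      exact Fin.cases (by omega) (Fin.cases (by simp; omega) fun t => hl ▸ (h5.2.2 t).1)
    exact ⟨fun t => ⟨i t, hlt t⟩, (isOccurrence_pattern21d_iff π _).2 hi, rfl⟩

theorem Equiv.Perm.toWord_injective (n : ℕ) :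
    Function.Injective (toWord : Equiv.Perm (Fin n) → List ℕ) := fun _ _ h =>
  Equiv.ext fun i => Fin.ext (congrFun (ofFn_injective h) i)

theorem Equiv.Perm.toWord_perm {n : ℕ} (π : Equiv.Perm (Fin n)) : π.toWord ~ range' 0 n := by
  refine (perm_ext_iff_of_nodup ?_ nodup_range').2 fun a => ?_
  · exact nodup_ofFn.2 (Fin.val_injective.comp π.injective)
  · simp only [toWord, mem_ofFn, mem_range'_1]
    constructor
    · rintro ⟨i, rfl⟩
      simp
    · intro h
      exact ⟨π.symm ⟨a, by omega⟩, by simp⟩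

theorem exists_toWord_eq {n : ℕ} {l : List ℕ} (h : l ~ range' 0 n) :
    ∃ π : Equiv.Perm (Fin n), π.toWord = l := by
  have hl : l.length = n := by simpa using h.length_eq
  subst hl
  have hlt : ∀ i : Fin l.length, l[i] < l.length := fun i => by
    simpa using (mem_range'_1.1 (h.mem_iff.1 (getElem_mem i.2))).2
  have hinj : Function.Injective (fun i : Fin l.length => (⟨l[i], hlt i⟩ : Fin l.length)) := by
    intro i i' hi
    exact Fin.ext ((h.nodup_iff.2 nodup_range').getElem_inj_iff.1 (Fin.ext_iff.1 hi))
  refine ⟨Equiv.ofBijective _ (Finite.injective_iff_bijective.1 hinj), ?_⟩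
  simp [Equiv.Perm.toWord]

end

/-! ### The functional equation of the tree series. -/

namespace MotzkinTree

open List in
theorem finite_size_eq (n : ℕ) : {t : MotzkinTree | t.size = n}.Finite := by
  refine Set.Finite.of_finite_image ((Set.finite_range
    (Equiv.Perm.toWord : Equiv.Perm (Fin n) → List ℕ)).subset ?_)
    (fun t _ t' _ h => word_injective (off := 0) h)
  rintro _ ⟨t, ht, rfl⟩
  exact exists_toWord_eq ((show t.size = n from ht) ▸ t.word_perm 0)

/-- The Motzkin trees of size `n`. -/
noncomputable def trees (n : ℕ) : Finset MotzkinTree := (finite_size_eq n).toFinset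

theorem mem_trees {n : ℕ} {t : MotzkinTree} : t ∈ trees n ↔ t.size = n := by
  simp [trees]

theorem trees_zero : trees 0 = {nil} := by
  ext t
  cases t <;> simp [mem_trees, size]

theorem trees_one : trees 1 = {one nil} := by
  ext t
  rcases t with _ | t | _ <;> simp [mem_trees, size]
  cases t <;> simp [size]

theorem sum_trees_add_two {M : Type*} [AddCommMonoid M] (f : MotzkinTree → M) (n : ℕ) :
    ∑ t ∈ trees (n + 2), f t = ∑ t ∈ trees (n + 1), f (one t) +
      ∑ p ∈ Finset.HasAntidiagonal.antidiagonal n, ∑ σ ∈ trees p.1, ∑ τ ∈ trees p.2, f (two σ τ) := by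
  have h : trees (n + 2) = (trees (n + 1)).image one ∪ ((Finset.HasAntidiagonal.antidiagonal n).sigma
      fun p => trees p.1 ×ˢ trees p.2).image fun x => two x.2.1 x.2.2 := by
    ext t
    rcases t with _ | t | ⟨σ, τ⟩ <;> simp [mem_trees, size]
  rw [h, Finset.sum_union, Finset.sum_image, Finset.sum_image, Finset.sum_sigma]
  · simp only [Finset.sum_product]
  · rintro ⟨⟨a, b⟩, σ, τ⟩ h ⟨⟨a', b'⟩, σ', τ'⟩ h' e
    simp only [Finset.coe_sigma, Set.mem_sigma_iff, Finset.mem_coe, Finset.mem_product, mem_trees,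
      two.injEq] at h h' e
    obtain ⟨-, rfl, rfl⟩ := h
    obtain ⟨-, rfl, rfl⟩ := h'
    obtain ⟨rfl, rfl⟩ := e
    rfl
  · exact fun t _ t' _ e => one.inj e
  · rw [Finset.disjoint_left]
    simp

open Polynomial in
/-- The generating function of Motzkin trees by size and weight. -/
noncomputable def weightGF (K i : ℕ) : PowerSeries ℚ[X] :=
  PowerSeries.mk fun n => ∑ t ∈ trees n, X ^ weight K i t

open Polynomial in
theorem weightGF_eq (K i : ℕ) : weightGF K i = 1 + PowerSeries.C X ^ i.choose K *
    (PowerSeries.X * weightGF K i + PowerSeries.X ^ 2 * (weightGF K i * weightGF K (i + 1))) := by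
  ext1 n
  rw [← map_pow, map_add, PowerSeries.coeff_C_mul, map_add, PowerSeries.coeff_one]
  rcases n with _ | _ | n
  · simp [weightGF, trees_zero, weight]
  · have h : PowerSeries.coeff 1 (PowerSeries.X ^ 2 * (weightGF K i * weightGF K (i + 1))) = 0 := by
      rw [PowerSeries.coeff_X_pow_mul', if_neg (by norm_num)]
    simp only [zero_add] at *
    rw [h, ← zero_add 1, PowerSeries.coeff_succ_X_mul]
    simp [weightGF, trees_zero, trees_one, weight]
  · rw [PowerSeries.coeff_succ_X_mul, show n + 1 + 1 = n + 2 from rfl,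
      PowerSeries.coeff_X_pow_mul, PowerSeries.coeff_mul]
    simp only [weightGF, PowerSeries.coeff_mk, sum_trees_add_two, weight, pow_add]
    rw [if_neg (by omega), zero_add, mul_add, Finset.mul_sum, Finset.mul_sum]
    congr 1
    · exact Finset.sum_congr rfl fun _ _ => mul_comm _ _
    -- The sum over trees lists `σ` first, whereas the first factor of the product belongs to `τ`.
    · rw [← Finset.Nat.sum_antidiagonal_swap]
      refine Finset.sum_congr rfl fun p _ => ?_
      rw [Finset.sum_mul_sum, Finset.sum_comm, Finset.mul_sum]
      refine Finset.sum_congr rfl fun σ _ => ?_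
      rw [Finset.mul_sum]
      exact Finset.sum_congr rfl fun τ _ => by ring

end MotzkinTree

/-! ### Rescaled Chebyshev polynomials and coefficients in `y`. -/

/-- The series `x ^ (m - 1) * U_{m - 1}((1 - x) / (2 * x))`. -/
noncomputable def chebPoly : ℕ → PowerSeries ℚ
  | 0 => 0
  | 1 => 1
  | m + 2 => (1 - PowerSeries.X) * chebPoly (m + 1) - PowerSeries.X ^ 2 * chebPoly m

/-- A Cassini identity: the left side is multiplied by `x²` at each step of the recurrence. It
supplies the determinant of the Möbius map. -/
theorem chebPoly_sq_sub (m : ℕ) :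
    chebPoly (m + 1) ^ 2 - chebPoly (m + 2) * chebPoly m = PowerSeries.X ^ (2 * m) := by
  induction m with
  | zero => simp [chebPoly]
  | succ m ih =>
    rw [mul_add, pow_add, ← ih]
    rw [show chebPoly (m + 1 + 2) = (1 - PowerSeries.X) * chebPoly (m + 2) -
      PowerSeries.X ^ 2 * chebPoly (m + 1) from rfl, show m + 1 + 1 = m + 2 from rfl]
    have h : chebPoly (m + 2) = (1 - PowerSeries.X) * chebPoly (m + 1) -
      PowerSeries.X ^ 2 * chebPoly m := rfl
    linear_combination chebPoly (m + 2) * h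

theorem constantCoeff_chebPoly_succ (m : ℕ) : PowerSeries.constantCoeff (chebPoly (m + 1)) = 1 := by
  induction m with
  | zero => simp [chebPoly]
  | succ m ih => simp [chebPoly, ih]

namespace PowerSeries

open Polynomial

/-- The coefficient of `y ^ r` in a power series in `x` with coefficients polynomial in `y`. -/
noncomputable def innerCoeff (r : ℕ) : PowerSeries ℚ[X] →+ PowerSeries ℚ where
  toFun F := mk fun n => (coeff n F).coeff r
  map_zero' := by ext; simp
  map_add' _ _ := by ext; simp

theorem innerCoeff_map_mul (r : ℕ) (a : PowerSeries ℚ) (F : PowerSeries ℚ[X]) :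
    innerCoeff r (map Polynomial.C a * F) = a * innerCoeff r F := by
  ext n
  simp [innerCoeff, coeff_mul]

theorem innerCoeff_map (r : ℕ) (a : PowerSeries ℚ) :
    innerCoeff r (map Polynomial.C a) = if r = 0 then a else 0 := by
  ext n
  simp only [innerCoeff, AddMonoidHom.coe_mk, ZeroHom.coe_mk, coeff_mk, coeff_map,
    Polynomial.coeff_C]
  split <;> simp

theorem innerCoeff_succ_X_mul (r : ℕ) (F : PowerSeries ℚ[X]) :
    innerCoeff (r + 1) (C Polynomial.X * F) = innerCoeff r F := by
  ext n
  simp [innerCoeff, coeff_C_mul]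

theorem innerCoeff_zero_X_mul (F : PowerSeries ℚ[X]) :
    innerCoeff 0 (C Polynomial.X * F) = 0 := by
  ext n
  simp [innerCoeff, coeff_C_mul]

theorem innerCoeff_X_pow_mul_of_lt {r s : ℕ} (h : r < s) (F : PowerSeries ℚ[X]) :
    innerCoeff r (C Polynomial.X ^ s * F) = 0 := by
  ext n
  simp only [innerCoeff, AddMonoidHom.coe_mk, ZeroHom.coe_mk, coeff_mk, ← map_pow, coeff_C_mul,
    Polynomial.coeff_X_pow_mul', if_neg h.not_ge, map_zero]

end PowerSeries

/-! ### Solving for the coefficients of the tree series. -/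

namespace MotzkinTree

open PowerSeries

/-- Below index `K` the equation reads `F = 1 / (1 - x - x² F')`, with `F'` the next series;
composing these maps produces the recurrence of `chebPoly`. -/
theorem weightGF_moebius (K i : ℕ) (hi : i + 1 ≤ K) :
    weightGF K (K - (i + 1)) * (map Polynomial.C (chebPoly (i + 2)) -
      X ^ 2 * map Polynomial.C (chebPoly (i + 1)) * weightGF K K) =
      map Polynomial.C (chebPoly (i + 1)) - X ^ 2 * map Polynomial.C (chebPoly i) * weightGF K K := by
  have rec_eq : ∀ m, map Polynomial.C (chebPoly (m + 2)) = (1 - X) * map Polynomial.C (chebPoly (m + 1))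
      - X ^ 2 * map Polynomial.C (chebPoly m) := fun m => by
    simp [chebPoly]
  induction i with
  | zero =>
    have h := weightGF_eq K (K - 1)
    rw [Nat.choose_eq_zero_of_lt (by omega), Nat.sub_add_cancel hi, pow_zero] at h
    rw [rec_eq]
    simp only [chebPoly, map_zero, map_one, zero_add]
    linear_combination h
  | succ i ih =>
    have h := weightGF_eq K (K - (i + 1 + 1))
    rw [Nat.choose_eq_zero_of_lt (by omega), show K - (i + 1 + 1) + 1 = K - (i + 1) by omega,
      pow_zero] at h
    have ih := ih (by omega)
    rw [rec_eq (i + 1)]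
    have e := rec_eq i
    rw [show i + 1 + 1 = i + 2 from rfl] at *
    linear_combination (map Polynomial.C (chebPoly (i + 2)) -
      X ^ 2 * map Polynomial.C (chebPoly (i + 1)) * weightGF K K) * h +
      X ^ 2 * weightGF K (K - (i + 2)) * ih - X ^ 2 * weightGF K (K - (i + 2)) * weightGF K K * e

theorem exists_weightGF_zero (j : ℕ) : ∃ S : PowerSeries (Polynomial ℚ),
    map Polynomial.C (chebPoly (j + 2) - X ^ 2 * chebPoly (j + 1)) * weightGF (j + 1) 0 =
      map Polynomial.C (chebPoly (j + 1) - X ^ 2 * chebPoly j) +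
      C Polynomial.X * (map Polynomial.C ((X + X ^ 2) * chebPoly (j + 2)) * weightGF (j + 1) 0) -
      C Polynomial.X * map Polynomial.C ((X + X ^ 2) * chebPoly (j + 1)) +
      C Polynomial.X ^ (j + 3) * S := by
  have h1 := weightGF_eq (j + 1) (j + 1)
  have h2 := weightGF_eq (j + 1) (j + 1 + 1)
  rw [Nat.choose_self, pow_one] at h1
  rw [show (j + 1 + 1).choose (j + 1) = j + 2 by simp] at h2
  have h3 := weightGF_moebius (j + 1) j le_rfl
  rw [Nat.sub_self] at h3
  set E := weightGF (j + 1) (j + 1)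
  set G := weightGF (j + 1) 0
  set F := weightGF (j + 1) (j + 1 + 1)
  set F' := X * F + X ^ 2 * (F * weightGF (j + 1) (j + 1 + 1 + 1))
  -- Here `(1 - (x + x²) y) E = 1 + y^(j+3) x² E F'`; `S` is that error `x² E F'` times the factor
  -- which multiplies `E` in `h3`.
  refine ⟨X ^ 2 * E * F' * (G * X ^ 2 * map Polynomial.C (chebPoly (j + 1)) -
    X ^ 2 * map Polynomial.C (chebPoly j)), ?_⟩
  simp only [map_sub, map_mul, map_add, map_pow, map_X]
  rw [h2] at h1
  set y : PowerSeries (Polynomial ℚ) := C Polynomial.X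
  linear_combination (1 - (X + X ^ 2) * y) * h3 + (G * X ^ 2 * map Polynomial.C (chebPoly (j + 1)) -
    X ^ 2 * map Polynomial.C (chebPoly j)) * h1

theorem innerCoeff_weightGF_zero (j : ℕ) :
    (chebPoly (j + 2) - X ^ 2 * chebPoly (j + 1)) * innerCoeff 0 (weightGF (j + 1) 0) =
      chebPoly (j + 1) - X ^ 2 * chebPoly j := by
  obtain ⟨S, hS⟩ := exists_weightGF_zero j
  have := congrArg (innerCoeff 0) hS
  rwa [map_add (innerCoeff _), map_sub (innerCoeff _), map_add (innerCoeff _), innerCoeff_zero_X_mul,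
    innerCoeff_zero_X_mul, innerCoeff_map_mul, innerCoeff_map,
    innerCoeff_X_pow_mul_of_lt (show 0 < j + 3 by omega), if_pos rfl, add_zero, add_zero,
    sub_zero] at this

theorem innerCoeff_weightGF_succ (j r : ℕ) (hr : r ≤ j + 1) :
    (chebPoly (j + 2) - X ^ 2 * chebPoly (j + 1)) ^ (r + 2) *
      innerCoeff (r + 1) (weightGF (j + 1) 0) =
      (X + X ^ 2) ^ (r + 1) * chebPoly (j + 2) ^ r * X ^ (2 * (j + 1)) := by
  obtain ⟨S, hS⟩ := exists_weightGF_zero j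
  have h := congrArg (innerCoeff (r + 1)) hS
  rw [map_add (innerCoeff _), map_sub (innerCoeff _), map_add (innerCoeff _),
    innerCoeff_succ_X_mul, innerCoeff_succ_X_mul, innerCoeff_map_mul,
    innerCoeff_map_mul, innerCoeff_map, innerCoeff_map,
    innerCoeff_X_pow_mul_of_lt (show r + 1 < j + 3 by omega), if_neg (by omega), zero_add,
    add_zero] at h
  induction r with
  | zero =>
    have h0 := innerCoeff_weightGF_zero j
    have hc := chebPoly_sq_sub j
    rw [if_pos rfl] at h
    -- Only the coefficient of `y` sees the inhomogeneous term; substituting the constant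
    -- coefficient leaves the Cassini determinant. Later coefficients just gain a constant ratio.
    linear_combination (chebPoly (j + 2) - X ^ 2 * chebPoly (j + 1)) * h +
      (X + X ^ 2) * chebPoly (j + 2) * h0 + (X + X ^ 2) * X ^ 2 * hc
  | succ r ih =>
    have h' := congrArg (innerCoeff (r + 1)) hS
    rw [map_add (innerCoeff _), map_sub (innerCoeff _), map_add (innerCoeff _),
    innerCoeff_succ_X_mul, innerCoeff_succ_X_mul, innerCoeff_map_mul,
      innerCoeff_map_mul, innerCoeff_map, innerCoeff_map,
      innerCoeff_X_pow_mul_of_lt (show r + 1 < j + 3 by omega), if_neg (by omega), zero_add,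
      add_zero] at h'
    have ih := ih (by omega) h'
    rw [if_neg (by omega), sub_zero] at h
    rw [pow_succ, mul_assoc, h]
    linear_combination (X + X ^ 2) * chebPoly (j + 2) * ih

end MotzkinTree

open MotzkinTree PowerSeries in
-- At `i = 0` every binomial weight except that of `d_(j+1)` vanishes, so tree weight is the number
-- of occurrences.
theorem motzkinGF_pattern21d (j r : ℕ) :
    motzkinGF (pattern21d (j + 3)) r = innerCoeff r (weightGF (j + 1) 0) := by
  ext n
  have hw : ∀ t : MotzkinTree, List.descCount (j + 1) (t.word 0) = weight (j + 1) 0 t := fun t => by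
    rw [← sum_descCount_word (j + 1) 0 0, Finset.sum_range_succ, Finset.sum_eq_zero]
    · simp
    · intro i hi
      rw [Nat.choose_eq_zero_of_lt (by have := Finset.mem_range.1 hi; omega), zero_mul]
  have hcard : {π : Equiv.Perm (Fin n) | IsMotzkin π ∧ numOccurrences (pattern21d (j + 3)) π = r}.ncard
      = ((trees n).filter fun t => weight (j + 1) 0 t = r).card := by
    rw [← Set.ncard_coe_finset, ← Set.ncard_image_of_injective _ (Equiv.Perm.toWord_injective n),
      ← Set.ncard_image_of_injective _ (fun t t' h => word_injective (off := 0) h)]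
    congr 1
    ext l
    simp only [Set.mem_image, Set.mem_ofPred_eq, Finset.coe_filter, mem_trees,
      numOccurrences_pattern21d (Nat.succ_ne_zero j), isMotzkin_iff_toWord, ← hw]
    constructor
    · rintro ⟨π, ⟨h1, h2⟩, rfl⟩
      obtain ⟨t, ht, e⟩ := exists_word_eq n 0 _ π.toWord_perm h1
      exact ⟨t, ⟨ht, e ▸ h2⟩, e⟩
    · rintro ⟨t, ⟨rfl, h2⟩, rfl⟩
      obtain ⟨π, e⟩ := exists_toWord_eq (t.word_perm 0)
      exact ⟨π, ⟨e ▸ isMotzkinWord_word t 0, e ▸ h2⟩, e⟩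
  simp only [motzkinGF, coeff_mk, hcard, innerCoeff, weightGF, AddMonoidHom.coe_mk, ZeroHom.coe_mk,
    Polynomial.finsetSum_coeff, Polynomial.coeff_X_pow]
  rw [Finset.sum_boole]
  simp only [eq_comm]

/-! ### Translation to Chebyshev polynomials in Laurent series. -/

theorem xL_ne_zero : xL ≠ 0 := by
  simp [xL]

theorem xL_mul_chebU (m : ℤ) : xL * chebU (m + 2) = (1 - xL) * chebU (m + 1) - xL * chebU m := by
  have h2 : (2 : LaurentSeries ℚ) ≠ 0 := by
    rw [← map_ofNat (algebraMap ℚ (LaurentSeries ℚ)) 2]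
    exact (map_ne_zero _).2 two_ne_zero
  simp only [chebU, Polynomial.Chebyshev.U_add_two, map_sub, map_mul, Polynomial.aeval_X, map_ofNat]
  field_simp [xL_ne_zero]

/-- The extra factor `xL` keeps the exponent natural at `m = 0`. -/
theorem coe_chebPoly (m : ℕ) : xL * ((chebPoly m : PowerSeries ℚ) : LaurentSeries ℚ) =
    xL ^ m * chebU (m - 1) := by
  induction m using Nat.twoStepInduction with
  | zero => simp [chebPoly, chebU]
  | one => simp [chebPoly, chebU]
  | more m h1 h2 =>
    have h := xL_mul_chebU (m - 1)
    have e : ((chebPoly (m + 2) : PowerSeries ℚ) : LaurentSeries ℚ) =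
      (1 - xL) * ((chebPoly (m + 1) : PowerSeries ℚ) : LaurentSeries ℚ) -
        xL ^ 2 * ((chebPoly m : PowerSeries ℚ) : LaurentSeries ℚ) := by
      simp only [chebPoly, xL, map_sub, map_mul, map_one, map_pow]
    push_cast at h2 ⊢
    rw [show (m : ℤ) - 1 + 2 = m + 2 - 1 by ring, show (m : ℤ) - 1 + 1 = m + 1 - 1 by ring] at h
    rw [e]
    linear_combination (1 - xL) * h2 - xL ^ 2 * h1 - xL ^ (m + 1) * h

theorem mainTheorem12 (k : ℕ) (hk : 3 ≤ k) :
    ((motzkinGF (pattern21d k) 0 : PowerSeries ℚ) : LaurentSeries ℚ) =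
        (chebU ((k : ℤ) - 3) - xL * chebU ((k : ℤ) - 4)) /
          (xL * (chebU ((k : ℤ) - 2) - xL * chebU ((k : ℤ) - 3))) ∧
      ∀ r : ℕ, 1 ≤ r → r ≤ k - 1 →
        ((motzkinGF (pattern21d k) r : PowerSeries ℚ) : LaurentSeries ℚ) =
          xL ^ r * (1 + xL) ^ r * chebU ((k : ℤ) - 2) ^ (r - 1) /
            (chebU ((k : ℤ) - 2) - xL * chebU ((k : ℤ) - 3)) ^ (r + 1) := by
  obtain ⟨j, rfl⟩ := Nat.exists_eq_add_of_le' hk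
  have hx := xL_ne_zero
  have a0 := coe_chebPoly j
  have a1 := coe_chebPoly (j + 1)
  have a2 := coe_chebPoly (j + 2)
  push_cast at a1 a2 ⊢
  rw [show (j : ℤ) + 3 - 4 = j - 1 by ring, show (j : ℤ) + 3 - 3 = j + 1 - 1 by ring,
    show (j : ℤ) + 3 - 2 = j + 2 - 1 by ring]
  set u0 := chebU (j - 1)
  set u1 := chebU (j + 1 - 1)
  set u2 := chebU (j + 2 - 1)
  have b1 : ((chebPoly (j + 1) : PowerSeries ℚ) : LaurentSeries ℚ) = xL ^ j * u1 :=
    mul_left_cancel₀ hx (by rw [a1]; ring)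
  have b2 : ((chebPoly (j + 2) : PowerSeries ℚ) : LaurentSeries ℚ) = xL ^ (j + 1) * u2 :=
    mul_left_cancel₀ hx (by rw [a2]; ring)
  have hD : ((chebPoly (j + 2) - PowerSeries.X ^ 2 * chebPoly (j + 1) : PowerSeries ℚ) :
      LaurentSeries ℚ) = xL ^ (j + 1) * (u2 - xL * u1) := by
    rw [map_sub, map_mul, map_pow, b1, b2, ← xL]
    ring
  -- Up to a power of `x` this is a power series with constant term 1.
  have hd : u2 - xL * u1 ≠ 0 := by
    have h0 : chebPoly (j + 2) - PowerSeries.X ^ 2 * chebPoly (j + 1) ≠ 0 := fun h => by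
      simpa [constantCoeff_chebPoly_succ] using congrArg PowerSeries.constantCoeff h
    intro h
    rw [h, mul_zero, ← map_zero (HahnSeries.ofPowerSeries ℤ ℚ)] at hD
    exact h0 (HahnSeries.ofPowerSeries_injective hD)
  constructor
  · have h := congrArg (HahnSeries.ofPowerSeries ℤ ℚ) (MotzkinTree.innerCoeff_weightGF_zero j)
    rw [← motzkinGF_pattern21d, map_mul, hD, map_sub, map_mul, map_pow, b1, ← xL] at h
    rw [eq_div_iff (mul_ne_zero hx hd)]
    refine mul_left_cancel₀ (pow_ne_zero j hx) ?_
    linear_combination h - xL * a0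
  · intro r hr hr'
    obtain ⟨r, rfl⟩ := Nat.exists_eq_add_of_le' hr
    have h := congrArg (HahnSeries.ofPowerSeries ℤ ℚ)
      (MotzkinTree.innerCoeff_weightGF_succ j r (by omega))
    simp only [← motzkinGF_pattern21d] at h
    rw [map_mul, map_pow, hD, map_mul, map_mul, map_pow, map_add, map_pow, map_pow, map_pow,
      b2, ← xL] at h
    rw [eq_div_iff (pow_ne_zero _ hd), Nat.add_sub_cancel]
    -- Both sides carry this power of `x`: from the denominator on one, and from `chebPoly (j + 2) ^
    -- r` and the determinant `x^(2(j+1))` on the other.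
    refine mul_left_cancel₀ (pow_ne_zero ((j + 1) * (r + 2)) hx) ?_
    rw [mul_pow, ← pow_mul, show xL + xL ^ 2 = xL * (1 + xL) by ring,
      mul_pow xL (1 + xL)] at h
    linear_combination h
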